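/- For a finite tree $T$ let $W(T)=\sum_{\{u,v\}\subset V(T)} d(u,v)$ be its Wiener index (the sum of the distances over all unordered pairs of vertices), and for integers $d\ge 2$ and $n>d$ let $W^T_{n,d}$ be the maximum of $W(T)$ over all trees $T$ with $n$ vertices and diameter $d$. There exist functions $f$ and $h$ of $d$ with $f(d)=o(d^{3/2})$ and $h(d)=O(\sqrt d)$ as $d\to\infty$ such that, for every fixed even $d\ge 2$, as $n\to\infty$, $$ \frac d2 n^2-\left(\frac{29}{60}d^{3/2}+f(d)\right)n^{3/2}+O_d(n)\;\le\; W^T_{n,d}\;\le\;\frac d2 n^2-\left(\frac{\sqrt2}{3}d^{3/2}+h(d)\right)n^{3/2}+O_d(n).$$ Likewise there exist functions $f$ and $h$ of $d$ with $f(d)=o(d^{3/2})$ and $h(d)=O(\sqrt d)$ as $d\to\infty$ such that, for every fixed odd $d\ge 3$, as $n\to\infty$, $$ \frac{d-0.5}2 n^2-\left(\frac{29}{60}d^{3/2}+f(d)\right)n^{3/2}+O_d(n)\;\le\; W^T_{n,d}\;\le\;\frac{d-0.5}2 n^2-\left(\frac{\sqrt2}{3}d^{3/2}+h(d)\right)n^{3/2}+O_d(n).$$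 Here $O_d(n)$ stands for a function of $n$ and $d$ such that, for every $d$, there are constants $x_0,M>0$ (depending on $d$) for which its absolute value is at most $Mn$ for all $n\ge x_0$. -/

import Mathlib

open Filter Asymptotics

/-- The Wiener index `∑_{{u,v} ⊆ V} d(u,v)` of a graph: the sum of the distances between all
unordered pairs of vertices. (The degenerate pairs `s(v, v)` contribute `dist v v = 0`.) -/
noncomputable def SimpleGraph.wienerIndex {V : Type*} [Fintype V] [DecidableEq V] (G : SimpleGraph V) : ℕ :=
  ∑ e : Sym2 V, Sym2.lift ⟨fun u v => G.dist u v, fun _ _ => G.dist_comm⟩ e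

/-- The set of Wiener indices of trees of order `n` and diameter `d`. -/
def treeWienerIndices (n d : ℕ) : Set ℕ :=
  {w | ∃ T : SimpleGraph (Fin n), T.IsTree ∧ T.diam = d ∧ T.wienerIndex = w}

/-- `W^T_{n,d}`: the maximum Wiener index among all trees of order `n` and diameter `d`. -/
noncomputable def maxTreeWiener (n d : ℕ) : ℕ :=
  sSup (treeWienerIndices n d)

/-- The supremum is an actual maximum as soon as a tree of order `n` and diameter `d` exists. -/
theorem isGreatest_maxTreeWiener {n d : ℕ} (h : (treeWienerIndices n d).Nonempty) :
    IsGreatest (treeWienerIndices n d) (maxTreeWiener n d) := by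
  have hfin : (treeWienerIndices n d).Finite :=
    (Set.finite_range (fun T : SimpleGraph (Fin n) => T.wienerIndex)).subset
      (by rintro w ⟨T, -, -, rfl⟩; exact ⟨T, rfl⟩)
  exact ⟨Nat.sSup_mem h hfin.bddAbove, fun w hw => le_csSup hfin.bddAbove hw⟩

/-!
Write the diameter as `d = 2 r + ε` with `ε ∈ {0, 1}`. A tree of diameter `d` has `ε + 1` centres,
forming a vertex or an edge, such that every vertex has distance at most `r`, its *level*, from the
nearest centre. Up to lower order terms, `n` vertices of level `r` in pairwise different branches,
evenly distributed around the centres, would give the Wiener index `(r + ε / 4) n²`. Two effects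
reduce this number: every vertex of level `j < r` costs `(r - j) n`, and every level `j` costs the
sum of `|F|²`, where `F` runs over the sets of descendants of the vertices of that level.

*Upper bound.* Let `m` be the number of vertices of level `j`, and `N` the number of vertices of
level at least `j`. Since `∑ |F|² ≥ 2 λ N - λ² m` for every `λ`, the choice `λ² = (r - j) n` shows
that level `j` costs at least `2 √((r - j) n) N` altogether. Here `N = n - O(√n)`, unless there are
so many vertices of level below `r` that their own cost is sufficient. Summing over `j` gives the
loss `∑ 2 √(r - j) · n ^ (3 / 2)`, whose coefficient is `(4 / 3) r ^ (3 / 2) + O(√r)`, that is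
`(√2 / 3) d ^ (3 / 2) + O(√d)`. See `SimpleGraph.IsTree.exists_centers` and
`sum_dist_le_of_levels`.

*Lower bound.* By the above, the number of vertices of level `j` should be close to `√(n / (r - j))`.
This is approximated by two values: about `(6 / 5) √(n / r)` paths, the *trunks*, start at the
centres, and each of them splits into two *arms* at distance about `r / 3` from the leaves. The
leaves are attached to the ends of the arms, as evenly as possible. The loss is
`(49 / 36) (r n) ^ (3 / 2) + O(n)`, and `49 / 36 < 2 √2 · 29 / 60`, so that the term `f(d)` can be
taken to be zero. Distances in this tree are bounded below by an explicit function which changes by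
at most one along every edge. See `level_add_level_le_dist`, `BroomVertex.le_sum_dist` and
`broom_loss_le`.
-/

/-! ### Distances in graphs and trees -/

/-- Twice the Wiener index is the sum of the distances over all ordered pairs. -/
theorem SimpleGraph.two_mul_wienerIndex {n : ℕ} (G : SimpleGraph (Fin n)) :
    2 * G.wienerIndex = ∑ u, ∑ v, G.dist u v := by
  have hW : G.wienerIndex =
      ∑ i ∈ (Finset.univ : Finset (Fin n)).offDiag with i.1 < i.2, G.dist i.1 i.2 := by
    have h := Finset.sum_sym2_filter_not_isDiag (Finset.univ : Finset (Fin n))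
      (Sym2.lift ⟨fun u v => G.dist u v, fun _ _ => G.dist_comm⟩)
    simp only [Sym2.lift_mk] at h
    rw [← h, SimpleGraph.wienerIndex, Finset.sym2_univ, Finset.sum_filter_of_ne]
    intro e
    induction e using Sym2.ind with
    | _ u v =>
      intro _ hne hdiag
      rw [Sym2.mk_isDiag_iff] at hdiag
      subst hdiag
      simp at hne
  have hset : (Finset.univ : Finset (Fin n)).offDiag.filter (fun i => i.1 < i.2)
      = Finset.univ.filter (fun i : Fin n × Fin n => i.1 < i.2) := by
    ext ⟨u, v⟩
    simp only [Finset.mem_filter, Finset.mem_offDiag, Finset.mem_univ, true_and]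
    exact ⟨fun h => h.2, fun h => ⟨h.ne, h⟩⟩
  rw [hset, Finset.sum_filter, Fintype.sum_prod_type] at hW
  have hW' : G.wienerIndex = ∑ u, ∑ v, if v < u then G.dist u v else 0 := by
    rw [hW, Finset.sum_comm]
    simp only [G.dist_comm]
  rw [two_mul]
  nth_rewrite 1 [hW]
  rw [hW', ← Finset.sum_add_distrib]
  refine Finset.sum_congr rfl fun u _ => ?_
  rw [← Finset.sum_add_distrib]
  refine Finset.sum_congr rfl fun v _ => ?_
  rcases lt_trichotomy u v with h | h | h
  · simp [h, h.asymm]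
  · simp [h]
  · simp [h, h.asymm]

/-- Every distance `j ≤ d(u, v)` is realised by a vertex of a geodesic from `u` to `v`. -/
theorem SimpleGraph.Connected.exists_dist_eq_of_le {V : Type*} {G : SimpleGraph V}
    (hG : G.Connected) {u v : V} {j : ℕ} (hj : j ≤ G.dist u v) :
    ∃ x, G.dist u x = j ∧ G.dist x v + j = G.dist u v := by
  obtain ⟨p, hp⟩ := hG.exists_walk_length_eq_dist u v
  refine ⟨p.getVert j, ?_⟩
  have h1 := SimpleGraph.dist_le (p.take j)
  have h2 := SimpleGraph.dist_le (p.drop j)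
  have h3 := hG.dist_triangle (u := u) (v := p.getVert j) (w := v)
  simp only [SimpleGraph.Walk.take_length, SimpleGraph.Walk.drop_length] at h1 h2
  omega

/-- In a tree, a vertex `c` between `u` and `w` lies between any vertex `x` and one of `u`, `w`:
otherwise the paths from `x` to `u` and `w` would join `u` to `w` without passing through `c`. -/
theorem SimpleGraph.IsTree.dist_eq_or_dist_eq {V : Type*} {G : SimpleGraph V}
    (hG : G.IsTree) {u c w : V} (h : G.dist u c + G.dist c w = G.dist u w) (x : V) :
    G.dist x c + G.dist c u = G.dist x u ∨ G.dist x c + G.dist c w = G.dist x w := by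
  classical
  have hc := hG.connected
  have key : ∀ y : V, ∀ P : G.Walk x y, P.length = G.dist x y → c ∈ P.support →
      G.dist x c + G.dist c y = G.dist x y := by
    intro y P hP hmem
    have h1 := SimpleGraph.dist_le (P.takeUntil c hmem)
    have h2 := SimpleGraph.dist_le (P.dropUntil c hmem)
    have h3 := congrArg SimpleGraph.Walk.length (P.take_spec hmem)
    have h4 := hc.dist_triangle (u := x) (v := c) (w := y)
    rw [SimpleGraph.Walk.length_append] at h3
    omega
  obtain ⟨P, hP⟩ := hc.exists_walk_length_eq_dist x u
  obtain ⟨Q, hQ⟩ := hc.exists_walk_length_eq_dist x w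
  by_cases hcP : c ∈ P.support
  · exact Or.inl (key u P hP hcP)
  by_cases hcQ : c ∈ Q.support
  · exact Or.inr (key w Q hQ hcQ)
  exfalso
  obtain ⟨A, hA⟩ := hc.exists_walk_length_eq_dist u c
  obtain ⟨B, hB⟩ := hc.exists_walk_length_eq_dist c w
  have hAB : (A.append B).IsPath := by
    apply SimpleGraph.Walk.isPath_of_length_eq_dist
    rw [SimpleGraph.Walk.length_append, hA, hB, h]
  have heq := (hG.existsUnique_path u w).unique hAB (P.reverse.append Q).bypass_isPath
  have hmem : c ∈ (P.reverse.append Q).bypass.support := by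
    rw [← heq, SimpleGraph.Walk.mem_support_append_iff]
    exact Or.inl A.end_mem_support
  have := SimpleGraph.Walk.support_bypass_subset_support _ hmem
  rw [SimpleGraph.Walk.mem_support_append_iff, SimpleGraph.Walk.support_reverse,
    List.mem_reverse] at this
  tauto

/-- A tree of diameter `2r + ε`, `ε ∈ {0, 1}`, has a centre: two vertices at distance `ε` (hence a
single one if `ε = 0`) such that every vertex is within distance `r` of one of them. -/
theorem SimpleGraph.IsTree.exists_centers {V : Type*} {G : SimpleGraph V} (hG : G.IsTree)
    {r ε : ℕ} (hε : ε ≤ 1) (hd : G.diam = 2 * r + ε) (hfin : G.ediam ≠ ⊤) :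
    ∃ c₀ c₁, G.dist c₀ c₁ = ε ∧ ∀ x, G.dist x c₀ ≤ r ∨ G.dist x c₁ ≤ r := by
  have hc := hG.connected
  have := hc.nonempty
  obtain ⟨u, w, huw⟩ := G.exists_dist_eq_diam
  obtain ⟨c₀, h1, h2⟩ := hc.exists_dist_eq_of_le (u := u) (v := w) (j := r) (by omega)
  obtain ⟨c₁, h3, h4⟩ := hc.exists_dist_eq_of_le (u := c₀) (v := w) (j := ε) (by omega)
  have h5 := hc.dist_triangle (u := u) (v := c₀) (w := c₁)
  have h6 := hc.dist_triangle (u := u) (v := c₁) (w := w)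
  refine ⟨c₀, c₁, h3, fun x => ?_⟩
  have k0 := hG.dist_eq_or_dist_eq (u := u) (c := c₀) (w := w) (by omega) x
  have k1 := hG.dist_eq_or_dist_eq (u := u) (c := c₁) (w := w) (by omega) x
  have hu := SimpleGraph.dist_le_diam hfin (u := x) (v := u)
  have hw := SimpleGraph.dist_le_diam hfin (u := x) (v := w)
  rw [G.dist_comm (u := c₀) (v := u), G.dist_comm (u := c₁) (v := u)] at *
  rcases Nat.le_one_iff_eq_zero_or_eq_one.1 hε with rfl | rfl
  · omega
  · have := hG.dist_ne_of_adj x (SimpleGraph.dist_eq_one_iff_adj.1 h3)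
    omega

/-! ### The upper bound -/

/-- The number of ordered pairs of `s` that `f` identifies is the sum of the squares of the sizes of
the fibres; the bound is `0 ≤ ∑ₓ (|fibre of x| - lam)²`. -/
theorem le_sum_ite_apply_eq {α β : Type*} [DecidableEq β] (s : Finset α) (t : Finset β)
    (f : α → β) (hf : ∀ u ∈ s, f u ∈ t) (lam : ℝ) :
    2 * lam * s.card - lam ^ 2 * t.card ≤
      ∑ u ∈ s, ∑ v ∈ s, if f u = f v then (1 : ℝ) else 0 := by
  have hpos : 0 ≤ ∑ x ∈ t, ((∑ u ∈ s, if f u = x then (1 : ℝ) else 0) - lam) ^ 2 :=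
    Finset.sum_nonneg fun x _ => sq_nonneg _
  have h1 : ∑ x ∈ t, (∑ u ∈ s, if f u = x then (1 : ℝ) else 0) = s.card := by
    rw [Finset.sum_comm, Finset.card_eq_sum_ones, Nat.cast_sum]
    refine Finset.sum_congr rfl fun u hu => ?_
    rw [Finset.sum_ite_eq, if_pos (hf u hu), Nat.cast_one]
  have h2 : ∑ x ∈ t, (∑ u ∈ s, if f u = x then (1 : ℝ) else 0) ^ 2 =
      ∑ u ∈ s, ∑ v ∈ s, if f u = f v then (1 : ℝ) else 0 := by
    simp only [sq, Finset.sum_mul_sum]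
    rw [Finset.sum_comm]
    refine Finset.sum_congr rfl fun u hu => ?_
    rw [Finset.sum_comm]
    refine Finset.sum_congr rfl fun v hv => ?_
    rw [Finset.sum_eq_single (f u)]
    · simp [eq_comm]
    · intro x _ hx
      simp [Ne.symm hx]
    · exact fun h => absurd (hf u hu) h
  have h3 : ∑ x ∈ t, ((∑ u ∈ s, if f u = x then (1 : ℝ) else 0) - lam) ^ 2 =
      (∑ x ∈ t, (∑ u ∈ s, if f u = x then (1 : ℝ) else 0) ^ 2)
        - 2 * lam * (∑ x ∈ t, (∑ u ∈ s, if f u = x then (1 : ℝ) else 0))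
        + lam ^ 2 * t.card := by
    rw [Finset.mul_sum, ← Finset.sum_sub_distrib, mul_comm (lam ^ 2), ← nsmul_eq_mul,
      ← Finset.sum_const, ← Finset.sum_add_distrib]
    exact Finset.sum_congr rfl fun x _ => by ring
  rw [h3, h1, h2] at hpos
  linarith

/-- A two-colouring of `n` points separates at most `n² / 2` ordered pairs. -/
theorem sum_ite_ne_le {V : Type*} [Fintype V] (side : V → Bool) :
    ∑ u, ∑ v, (if side u = side v then (0 : ℝ) else 1) ≤ (Fintype.card V : ℝ) ^ 2 / 2 := by
  have h := le_sum_ite_apply_eq Finset.univ Finset.univ side (fun _ _ => Finset.mem_univ _)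
    ((Fintype.card V : ℝ) / 2)
  have h2 : ∑ u, ∑ v, (if side u = side v then (0 : ℝ) else 1)
      + ∑ u, ∑ v, (if side u = side v then (1 : ℝ) else 0) = (Fintype.card V : ℝ) ^ 2 := by
    simp only [← Finset.sum_add_distrib]
    have : ∀ u v, (if side u = side v then (0 : ℝ) else 1) +
        (if side u = side v then (1 : ℝ) else 0) = 1 := by
      intro u v; split_ifs <;> norm_num
    simp [this, sq]
  simp only [Finset.card_univ, Fintype.card_bool] at h
  push_cast at h
  linarith

/-- The heart of the upper bound. The vertices of a graph are arranged in levels `0, …, r`, and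
`anc j v` is a vertex of level `j` between `v` and level `0`. -/
theorem sum_dist_le_of_levels {V : Type*} [Fintype V] [DecidableEq V] {G : SimpleGraph V}
    (hG : G.Connected) {r ε : ℕ} (lev : V → ℕ) (side : V → Bool) (anc : ℕ → V → V)
    (hlev : ∀ v, lev v ≤ r)
    (hanc : ∀ v j, j ≤ lev v → lev (anc j v) = j ∧ G.dist v (anc j v) + j ≤ lev v)
    (hdist : ∀ u v, G.dist u v ≤ lev u + lev v + ε * if side u = side v then 0 else 1) :
    (∑ u, ∑ v, (G.dist u v : ℝ)) / 2 ≤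
      (r + ε / 4 : ℝ) * (Fintype.card V : ℝ) ^ 2
        - (∑ j ∈ Finset.Ico 1 r, 2 * √((r : ℝ) - j)) * (Fintype.card V * √(Fintype.card V : ℝ))
        + (∑ j ∈ Finset.Ico 1 r, 2 * √((r : ℝ) - j)) ^ 2 * Fintype.card V := by
  set n : ℝ := (Fintype.card V : ℝ) with hn
  have hn0 : 0 ≤ n := Nat.cast_nonneg _
  set S : ℝ := ∑ j ∈ Finset.Ico 1 r, 2 * √((r : ℝ) - j) with hS
  have hS0 : 0 ≤ S := Finset.sum_nonneg fun j _ => by positivity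
  -- pairs of vertices with a common ancestor at level `j`
  let E : ℕ → V → V → ℝ := fun j u v =>
    if j ≤ lev u ∧ j ≤ lev v ∧ anc j u = anc j v then 1 else 0
  have hpair : ∀ u v, (G.dist u v : ℝ) ≤ lev u + lev v
      + ε * (if side u = side v then (0 : ℝ) else 1) - 2 * ∑ j ∈ Finset.Ico 1 r, E j u v := by
    intro u v
    have hsum : ∑ j ∈ Finset.Ico 1 r, E j u v = (((Finset.Ico 1 r).filter
        (fun j => j ≤ lev u ∧ j ≤ lev v ∧ anc j u = anc j v)).card : ℝ) := by
      simp only [E]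
      rw [Finset.sum_boole]
    rw [hsum]
    set F := (Finset.Ico 1 r).filter (fun j => j ≤ lev u ∧ j ≤ lev v ∧ anc j u = anc j v) with hF
    have hd : (if side u = side v then (0 : ℝ) else 1)
        = ((if side u = side v then 0 else 1 : ℕ) : ℝ) := by split_ifs <;> simp
    rw [hd]
    have key : G.dist u v + 2 * F.card ≤
        lev u + lev v + ε * (if side u = side v then 0 else 1) := by
      rcases F.eq_empty_or_nonempty with h0 | h0
      · rw [h0, Finset.card_empty]
        simpa using hdist u v
      · -- the deepest common ancestor, at level `J`, bounds the number of common levels by `J`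
        obtain ⟨J, hJ, hmax⟩ := F.exists_max_image id h0
        have hcard : F.card ≤ J := by
          have : F ⊆ Finset.Icc 1 J := fun j hj => by
            have h1 := (Finset.mem_Ico.1 (Finset.mem_filter.1 hj).1).1
            exact Finset.mem_Icc.2 ⟨h1, hmax j hj⟩
          simpa using Finset.card_le_card this
        obtain ⟨-, h1, h2, h3⟩ := Finset.mem_filter.1 hJ
        have a1 := (hanc u J h1).2
        have a2 := (hanc v J h2).2
        have a3 := hG.dist_triangle (u := u) (v := anc J u) (w := v)
        rw [h3, G.dist_comm (u := anc J v)] at a3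
        rw [h3] at a1
        omega
    have key' : (G.dist u v : ℝ) + 2 * F.card ≤
        lev u + lev v + ε * ((if side u = side v then 0 else 1 : ℕ) : ℝ) := by exact_mod_cast key
    linarith
  let N : ℕ → ℝ := fun j => ((Finset.univ.filter (fun v => j ≤ lev v)).card : ℝ)
  let m : ℕ → ℝ := fun j => ((Finset.univ.filter (fun v => lev v = j)).card : ℝ)
  have hE : ∀ j (lam : ℝ), 2 * lam * N j - lam ^ 2 * m j ≤ ∑ u, ∑ v, E j u v := by
    intro j lam
    refine (le_sum_ite_apply_eq (Finset.univ.filter (fun v => j ≤ lev v))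
      (Finset.univ.filter (fun v => lev v = j)) (anc j) (fun u hu => ?_) lam).trans_eq ?_
    · simp only [Finset.mem_filter, Finset.mem_univ, true_and] at hu ⊢
      exact (hanc u j hu).1
    · rw [Finset.sum_filter]
      refine Finset.sum_congr rfl fun u _ => ?_
      by_cases hu : j ≤ lev u
      · simp only [hu, if_true, Finset.sum_filter, E, true_and]
        exact Finset.sum_congr rfl fun v _ => by split_ifs <;> tauto
      · simp [hu, E]
  have htotal : ∑ u, ∑ v, (G.dist u v : ℝ) ≤ 2 * n * (∑ v, (lev v : ℝ)) + ε * (n ^ 2 / 2)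
      - 2 * ∑ j ∈ Finset.Ico 1 r, ∑ u, ∑ v, E j u v := by
    have h1 : ∑ u, ∑ v, (G.dist u v : ℝ) ≤ ∑ u, ∑ v, ((lev u : ℝ) + lev v
      + ε * (if side u = side v then (0 : ℝ) else 1) - 2 * ∑ j ∈ Finset.Ico 1 r, E j u v) :=
      Finset.sum_le_sum fun u _ => Finset.sum_le_sum fun v _ => hpair u v
    have h2 := mul_le_mul_of_nonneg_left (sum_ite_ne_le side) (Nat.cast_nonneg (α := ℝ) ε)
    have h3 : ∑ j ∈ Finset.Ico 1 r, ∑ u, ∑ v, E j u v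
        = ∑ u, ∑ v, ∑ j ∈ Finset.Ico 1 r, E j u v := by
      rw [Finset.sum_comm]
      exact Finset.sum_congr rfl fun u _ => Finset.sum_comm
    simp only [Finset.sum_add_distrib, Finset.sum_sub_distrib, ← Finset.mul_sum,
      Finset.sum_const, Finset.card_univ, nsmul_eq_mul] at h1
    rw [h3]
    linarith
  have hdef : ∑ v, (lev v : ℝ) = r * n - ∑ v, ((r : ℝ) - lev v) := by
    rw [Finset.sum_sub_distrib]
    simp [hn, mul_comm]
  set D : ℝ := ∑ v, ((r : ℝ) - lev v) with hD
  have hDm : ∑ j ∈ Finset.Ico 1 r, ((r : ℝ) - j) * m j ≤ D := by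
    have : ∀ j, ((r : ℝ) - j) * m j = ∑ v, if lev v = j then (r : ℝ) - lev v else 0 := by
      intro j
      rw [← Finset.sum_filter, Finset.sum_congr rfl (g := fun _ => (r : ℝ) - j), Finset.sum_const,
        nsmul_eq_mul, mul_comm]
      intro v hv
      rw [(Finset.mem_filter.1 hv).2]
    simp only [this]
    rw [Finset.sum_comm]
    refine Finset.sum_le_sum fun v _ => ?_
    rw [Finset.sum_ite_eq]
    have : (lev v : ℝ) ≤ r := by exact_mod_cast hlev v
    split_ifs <;> linarith
  set M : ℝ := ((Finset.univ.filter (fun v => lev v < r)).card : ℝ) with hM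
  have hDM : M ≤ D := by
    rw [hM, Finset.card_filter, Nat.cast_sum]
    refine Finset.sum_le_sum fun v _ => ?_
    have h1 := hlev v
    split_ifs with h
    · have : (lev v : ℝ) + 1 ≤ r := by exact_mod_cast h
      simp only [Nat.cast_one]; linarith
    · have : (lev v : ℝ) ≤ r := by exact_mod_cast h1
      simp only [Nat.cast_zero]; linarith
  have hNM : ∀ j ∈ Finset.Ico 1 r, n - M ≤ N j := by
    intro j hj
    have h1 := Finset.card_filter_add_card_filter_not (s := (Finset.univ : Finset V))
      (fun v => j ≤ lev v)
    have h2 : (Finset.univ.filter (fun v => ¬ j ≤ lev v)).card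
        ≤ (Finset.univ.filter (fun v => lev v < r)).card := by
      refine Finset.card_le_card fun v hv => ?_
      simp only [Finset.mem_filter, Finset.mem_univ, true_and] at hv ⊢
      have := (Finset.mem_Ico.1 hj).2
      omega
    have h1' : N j + ((Finset.univ.filter (fun v => ¬ j ≤ lev v)).card : ℝ) = n := by
      simp only [N, hn]
      rw [← Finset.card_univ]
      exact_mod_cast h1
    have h2' : ((Finset.univ.filter (fun v => ¬ j ≤ lev v)).card : ℝ) ≤ M := by
      rw [hM]
      exact_mod_cast h2
    linarith
  have hsq : √n * √n = n := Real.mul_self_sqrt hn0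
  -- `lam ^ 2 = n (r - j)` makes the cost of level `j` cancel against its deficiency `(r - j) n m`
  have hmain : 2 * √n * (∑ j ∈ Finset.Ico 1 r, √((r : ℝ) - j) * N j)
      - n * D ≤ ∑ j ∈ Finset.Ico 1 r, ∑ u, ∑ v, E j u v := by
    have h1 : ∀ j ∈ Finset.Ico 1 r, 2 * (√n * √((r : ℝ) - j)) * N j - n * (((r : ℝ) - j) * m j)
        ≤ ∑ u, ∑ v, E j u v := by
      intro j hj
      refine le_trans (le_of_eq ?_) (hE j (√n * √((r : ℝ) - j)))
      have hj' : (j : ℝ) ≤ r := by exact_mod_cast (Finset.mem_Ico.1 hj).2.le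
      rw [mul_pow, Real.sq_sqrt hn0, Real.sq_sqrt (by linarith)]
      ring
    have h2 := Finset.sum_le_sum h1
    rw [Finset.sum_sub_distrib, ← Finset.mul_sum] at h2
    have h3 := mul_le_mul_of_nonneg_left hDm hn0
    have h4 : ∑ j ∈ Finset.Ico 1 r, 2 * (√n * √((r : ℝ) - j)) * N j
        = 2 * √n * (∑ j ∈ Finset.Ico 1 r, √((r : ℝ) - j) * N j) := by
      rw [Finset.mul_sum]
      exact Finset.sum_congr rfl fun j _ => by ring
    linarith
  have hEpos : 0 ≤ ∑ j ∈ Finset.Ico 1 r, ∑ u, ∑ v, E j u v :=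
    Finset.sum_nonneg fun j _ => Finset.sum_nonneg fun u _ => Finset.sum_nonneg fun v _ => by
      simp only [E]; split_ifs <;> norm_num
  rw [hdef] at htotal
  rcases le_total M (S * √n) with hcase | hcase
  · have h1 : S * (n - M) ≤ 2 * ∑ j ∈ Finset.Ico 1 r, √((r : ℝ) - j) * N j := by
      rw [hS, Finset.sum_mul, Finset.mul_sum]
      refine Finset.sum_le_sum fun j hj => ?_
      have := mul_le_mul_of_nonneg_left (hNM j hj) (Real.sqrt_nonneg ((r : ℝ) - j))
      linarith
    have h2 := mul_le_mul_of_nonneg_left h1 (Real.sqrt_nonneg n)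
    have h3 := mul_le_mul_of_nonneg_left hcase (mul_nonneg hS0 (Real.sqrt_nonneg n))
    have h4 : S * √n * (S * √n) = S ^ 2 * n := by
      calc S * √n * (S * √n) = S ^ 2 * (√n * √n) := by ring
        _ = _ := by rw [hsq]
    nlinarith
  · -- too many vertices above level `r`: their deficiency alone suffices
    have h1 := mul_le_mul_of_nonneg_left (hcase.trans hDM) hn0
    have h2 : 0 ≤ S ^ 2 * n := by positivity
    nlinarith

/-- The upper bound for a single tree, with the exact coefficient of `n ^ (3 / 2)`. -/
theorem SimpleGraph.IsTree.wienerIndex_le {n : ℕ} {G : SimpleGraph (Fin n)} (hG : G.IsTree)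
    {r ε : ℕ} (hε : ε ≤ 1) (hd : G.diam = 2 * r + ε) :
    (G.wienerIndex : ℝ) ≤ (r + ε / 4 : ℝ) * (n : ℝ) ^ 2
        - (∑ j ∈ Finset.Ico 1 r, 2 * √((r : ℝ) - j)) * (n * √(n : ℝ))
        + (∑ j ∈ Finset.Ico 1 r, 2 * √((r : ℝ) - j)) ^ 2 * n := by
  have hc := hG.connected
  have := hc.nonempty
  obtain ⟨c₀, c₁, hcc, hr⟩ := hG.exists_centers hε hd (SimpleGraph.connected_iff_ediam_ne_top.1 hc)
  let lev : Fin n → ℕ := fun v => min (G.dist c₀ v) (G.dist c₁ v)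
  let side : Fin n → Bool := fun v => decide (G.dist c₀ v ≤ G.dist c₁ v)
  have hex : ∀ v j, ∃ x, j ≤ lev v → lev x = j ∧ G.dist v x + j ≤ lev v := by
    intro v j
    by_cases hj : j ≤ lev v
    · by_cases hs : G.dist c₀ v ≤ G.dist c₁ v
      · obtain ⟨x, hx1, hx2⟩ := hc.exists_dist_eq_of_le (u := c₀) (v := v) (j := j)
          (hj.trans (min_le_left _ _))
        refine ⟨x, fun _ => ?_⟩
        have h1 := hc.dist_triangle (u := c₁) (v := x) (w := v)
        have h2 := G.dist_comm (u := x) (v := v)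
        simp only [lev] at *
        omega
      · obtain ⟨x, hx1, hx2⟩ := hc.exists_dist_eq_of_le (u := c₁) (v := v) (j := j)
          (hj.trans (min_le_right _ _))
        refine ⟨x, fun _ => ?_⟩
        have h1 := hc.dist_triangle (u := c₀) (v := x) (w := v)
        have h2 := G.dist_comm (u := x) (v := v)
        simp only [lev] at *
        omega
    · exact ⟨v, fun h => absurd h hj⟩
  choose anc' hanc using hex
  have key := sum_dist_le_of_levels hc (r := r) (ε := ε) lev side (fun j v => anc' v j) ?_ hanc ?_
  · have h2 : (2 * G.wienerIndex : ℝ) = ∑ u, ∑ v, (G.dist u v : ℝ) := by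
      exact_mod_cast G.two_mul_wienerIndex
    rw [← h2] at key
    simpa using key
  · intro v
    have := hr v
    simp only [lev]
    rw [G.dist_comm (u := v), G.dist_comm (u := v)] at this
    omega
  · intro u v
    have a1 := hc.dist_triangle (u := u) (v := c₀) (w := v)
    have a2 := hc.dist_triangle (u := u) (v := c₁) (w := v)
    have a3 := hc.dist_triangle (u := u) (v := c₀) (w := c₁)
    have a4 := hc.dist_triangle (u := u) (v := c₁) (w := c₀)
    have b1 := hc.dist_triangle (u := c₀) (v := c₁) (w := v)
    have b2 := hc.dist_triangle (u := c₁) (v := c₀) (w := v)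
    have e1 := G.dist_comm (u := u) (v := c₀)
    have e2 := G.dist_comm (u := u) (v := c₁)
    have e3 := G.dist_comm (u := c₁) (v := c₀)
    simp only [lev, side, decide_eq_decide]
    split_ifs with h <;> omega

/-! ### The lower bound: a family of trees -/

/-- Isomorphisms of connected graphs preserve distances. -/
theorem SimpleGraph.Iso.dist_eq {V W : Type*} {G : SimpleGraph V} {H : SimpleGraph W}
    (φ : G ≃g H) (hG : G.Connected) (u v : V) : H.dist (φ u) (φ v) = G.dist u v := by
  have hH : H.Connected := φ.connected_iff.1 hG
  apply le_antisymm
  · obtain ⟨p, hp⟩ := hG.exists_walk_length_eq_dist u v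
    have := SimpleGraph.dist_le (p.map φ.toHom)
    rw [SimpleGraph.Walk.length_map, hp] at this
    exact this
  · obtain ⟨p, hp⟩ := hH.exists_walk_length_eq_dist (φ u) (φ v)
    have := SimpleGraph.dist_le (p.map φ.symm.toHom)
    rw [SimpleGraph.Walk.length_map, hp] at this
    simpa using this

/-- A lower bound for distances in a graph whose vertices carry a level `lev` and a label
`((z, i), b)`. Neighbours above level `0` lie on consecutive levels; `z` is constant along such
edges, `i` from level `1` on, and `b` from level `p + 1` on. Two vertices with
the same `(z, i)` can therefore only meet at a level at most `p` unless their labels `b` agree. -/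
theorem level_add_level_le_dist {V A B C : Type*} [DecidableEq A] [DecidableEq B] [DecidableEq C]
    {G : SimpleGraph V} (hG : G.Connected) (p : ℕ) (lev : V → ℕ) (lab : V → (A × B) × C)
    (hadj : ∀ v w, G.Adj v w → (lev v = 0 ∧ lev w = 0) ∨
      (lev v = lev w + 1 ∧ (lab v).1.1 = (lab w).1.1 ∧ (1 ≤ lev w → (lab v).1 = (lab w).1) ∧
        (p + 1 ≤ lev w → lab v = lab w)) ∨
      (lev w = lev v + 1 ∧ (lab w).1.1 = (lab v).1.1 ∧ (1 ≤ lev v → (lab w).1 = (lab v).1) ∧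
        (p + 1 ≤ lev v → lab w = lab v)))
    (u v : V) :
    lev u + lev v + (if (lab u).1.1 = (lab v).1.1 then 0 else 1) ≤ G.dist u v +
      2 * if (lab u).1 = (lab v).1 then
        (if lab u = lab v then min (lev u) (lev v) else min (min (lev u) (lev v)) p) else 0 := by
  obtain ⟨P, hP⟩ := hG.exists_walk_length_eq_dist u v
  rw [← hP]
  clear hP
  induction P with
  | nil => simp; omega
  | @cons u w v h P ih =>
    rw [SimpleGraph.Walk.length_cons]
    have h' := hadj u w h
    revert ih h'
    generalize lab u = lu, lab w = lw, lab v = lv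
    obtain ⟨⟨a, b⟩, c⟩ := lu
    obtain ⟨⟨a', b'⟩, c'⟩ := lw
    obtain ⟨⟨a'', b''⟩, c''⟩ := lv
    simp only [Prod.mk.injEq]
    intro ih h'
    rcases h' with ⟨h1, h2⟩ | ⟨h1, h2, h3, h4⟩ | ⟨h1, h2, h3, h4⟩
    · simp only [h1, h2] at *
      split_ifs at ih ⊢ <;> omega
    · subst h2
      rcases Nat.eq_zero_or_pos (lev w) with h0 | h0
      · simp only [h0, h1] at *
        split_ifs at ih ⊢ <;> omega
      · obtain ⟨-, rfl⟩ := h3 h0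
        by_cases hp : p + 1 ≤ lev w
        · obtain ⟨-, rfl⟩ := h4 hp
          split_ifs at ih ⊢ <;> omega
        · split_ifs at ih ⊢ <;> omega
    · subst h2
      rcases Nat.eq_zero_or_pos (lev u) with h0 | h0
      · simp only [h0, h1] at *
        split_ifs at ih ⊢ <;> omega
      · obtain ⟨-, rfl⟩ := h3 h0
        by_cases hp : p + 1 ≤ lev u
        · obtain ⟨-, rfl⟩ := h4 hp
          split_ifs at ih ⊢ <;> omega
        · split_ifs at ih ⊢ <;> omega

theorem card_filter_mod_eq_le (L M c : ℕ) :
    ((Finset.univ : Finset (Fin L)).filter (fun s => s.1 % M = c)).card ≤ L / M + 1 := by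
  rw [← Finset.card_range (L / M + 1)]
  refine Finset.card_le_card_of_injOn (fun s => s.1 / M) (fun s _ => ?_) fun s hs t ht h => ?_
  · have := Nat.div_le_div_right (c := M) s.2.le
    simp only [Finset.coe_range, Set.mem_Iio]
    omega
  · simp only [Finset.coe_filter, Finset.mem_univ, true_and, Set.mem_ofPred_eq] at hs ht h
    have h1 := Nat.div_add_mod s.1 M
    have h2 := Nat.div_add_mod t.1 M
    rw [h, hs, ← ht] at h1
    exact Fin.ext (h1.symm.trans h2)

/-- The vertices of a tree with `k` centres, each of which is the start of `m` trunks with `p`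
vertices, each of which splits into two arms with `q` vertices, together with `L` leaves. -/
abbrev BroomVertex (k m p q L : ℕ) : Type :=
  Fin k ⊕ ((Fin k × Fin m) × Fin p ⊕ (((Fin k × Fin m) × Fin 2) × Fin q ⊕ Fin L))

namespace BroomVertex

variable {k m p q L : ℕ}

/-- The distance from the nearest centre. -/
def level : BroomVertex k m p q L → ℕ
  | .inl _ => 0
  | .inr (.inl (_, j)) => j + 1
  | .inr (.inr (.inl (_, j))) => p + 1 + j
  | .inr (.inr (.inr _)) => p + q + 1

/-- The centre, the trunk and the arm to which a vertex belongs, where centres and trunks are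
counted with the trunk `0` and the arm `0`; the leaves are dealt out cyclically to the arms, such
that consecutive leaves belong to different centres if there are several. -/
def label [NeZero k] [NeZero m] : BroomVertex k m p q L → (Fin k × Fin m) × Fin 2
  | .inl z => ((z, 0), 0)
  | .inr (.inl (a, _)) => (a, 0)
  | .inr (.inr (.inl (a, _))) => a
  | .inr (.inr (.inr s)) => ((Fin.ofNat k s, Fin.ofNat m (s / k)), Fin.ofNat 2 (s / (k * m)))

/-- The vertex of level `j ≤ p + q` on the path from a centre along the arm `a`. -/
def node (a : (Fin k × Fin m) × Fin 2) (j : ℕ) : BroomVertex k m p q L :=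
  if h₀ : j = 0 then .inl a.1.1
  else if h₁ : j ≤ p then .inr (.inl (a.1, ⟨j - 1, by omega⟩))
  else if h₂ : j ≤ p + q then .inr (.inr (.inl (a, ⟨j - p - 1, by omega⟩)))
  else .inl a.1.1

/-- The neighbour of a vertex towards the centre `0`; that centre is its own parent. -/
def parent [NeZero k] [NeZero m] (v : BroomVertex k m p q L) : BroomVertex k m p q L :=
  if level v = 0 then .inl 0 else node (label v) (level v - 1)

theorem level_node (a : (Fin k × Fin m) × Fin 2) {j : ℕ} (hj : j ≤ p + q) :
    level (node a j : BroomVertex k m p q L) = j := by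
  unfold node
  split_ifs <;> simp only [level] <;> omega

theorem label_node [NeZero k] [NeZero m] (a : (Fin k × Fin m) × Fin 2) {j : ℕ} (hj : j ≤ p + q) :
    (label (node a j : BroomVertex k m p q L)).1.1 = a.1.1 ∧
    (1 ≤ j → (label (node a j : BroomVertex k m p q L)).1 = a.1) ∧
    (p + 1 ≤ j → label (node a j : BroomVertex k m p q L) = a) := by
  unfold node
  split_ifs <;> simp only [label] <;>
    refine ⟨?_, ?_, ?_⟩ <;> first | trivial | (intro; first | trivial | omega)

theorem level_le (v : BroomVertex k m p q L) : level v ≤ p + q + 1 := by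
  rcases v with z | ⟨a, j⟩ | ⟨a, j⟩ | s <;> simp only [level] <;> omega

theorem eq_inl_of_level_eq_zero [NeZero k] [NeZero m] {v : BroomVertex k m p q L}
    (h : level v = 0) : v = .inl (label v).1.1 := by
  rcases v with z | ⟨a, j⟩ | ⟨a, j⟩ | s
  · rfl
  all_goals simp only [level] at h; omega

/-- The tree in which every vertex is joined to its parent. -/
def graph (k m p q L : ℕ) [NeZero k] [NeZero m] : SimpleGraph (BroomVertex k m p q L) where
  Adj u v := u ≠ v ∧ (parent u = v ∨ parent v = u)
  symm := ⟨fun _ _ h => ⟨h.1.symm, h.2.symm⟩⟩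
  loopless := ⟨fun _ h => h.1 rfl⟩

section

variable [NeZero k] [NeZero m]

theorem parent_spec {v : BroomVertex k m p q L} (h : level v ≠ 0) :
    level v = level (parent v) + 1 ∧ (label v).1.1 = (label (parent v)).1.1 ∧
      (1 ≤ level (parent v) → (label v).1 = (label (parent v)).1) ∧
      (p + 1 ≤ level (parent v) → label v = label (parent v)) := by
  have hj : level v - 1 ≤ p + q := by have := level_le v; omega
  have h1 := level_node (L := L) (label v) hj
  have h2 := label_node (L := L) (label v) hj
  rw [parent, if_neg h, h1]
  exact ⟨by omega, h2.1.symm, fun h => (h2.2.1 h).symm, fun h => (h2.2.2 h).symm⟩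

theorem adj_parent {v : BroomVertex k m p q L} (h : level v ≠ 0) :
    (graph k m p q L).Adj v (parent v) :=
  ⟨fun e => by have := (parent_spec h).1; rw [← e] at this; omega, Or.inl rfl⟩

theorem adj_inl_zero {z : Fin k} (h : z ≠ 0) : (graph k m p q L).Adj (.inl z) (.inl 0) :=
  ⟨fun e => h (Sum.inl.inj e), Or.inl rfl⟩

theorem exists_walk_inl (v : BroomVertex k m p q L) :
    ∃ P : (graph k m p q L).Walk v (.inl (label v).1.1), P.length = level v := by
  generalize hl : level v = l
  induction l generalizing v with
  | zero =>
    have h := eq_inl_of_level_eq_zero hl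
    exact ⟨SimpleGraph.Walk.nil.copy rfl h, by simp⟩
  | succ l ih =>
    have h := parent_spec (v := v) (by omega)
    obtain ⟨P, hP⟩ := ih (parent v) (by omega)
    rw [h.2.1]
    exact ⟨P.cons (adj_parent (by omega)), by rw [SimpleGraph.Walk.length_cons, hP]⟩

theorem connected : (graph k m p q L).Connected := by
  rw [SimpleGraph.connected_iff_exists_forall_reachable]
  refine ⟨.inl 0, fun v => ?_⟩
  obtain ⟨P, -⟩ := exists_walk_inl v
  refine (P.reachable.trans ?_).symm
  by_cases h : (label v).1.1 = 0
  · rw [h]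
  · exact (adj_inl_zero h).reachable

theorem isTree : (graph k m p q L).IsTree := by
  classical
  refine SimpleGraph.isTree_iff_connected_and_card.2 ⟨connected, ?_⟩
  refine le_antisymm ?_ connected.card_vert_le_card_edgeSet_add_one
  -- the edges are the pairs `{v, parent v}` with `v ≠ inl 0`
  have hsub : (graph k m p q L).edgeSet ⊆
      ((Finset.univ.erase (Sum.inl 0)).image fun v => s(v, parent v) :
        Finset (Sym2 (BroomVertex k m p q L))) := by
    have key : ∀ u v : BroomVertex k m p q L, u ≠ v → parent u = v → u ≠ .inl 0 := by
      rintro u v huv hp rfl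
      exact huv hp
    intro e
    induction e using Sym2.ind with
    | _ u v =>
      rintro ⟨huv, h | h⟩
      · refine Finset.mem_coe.2 (Finset.mem_image.2 ⟨u, ?_, by rw [h]⟩)
        exact Finset.mem_erase.2 ⟨key u v huv h, Finset.mem_univ _⟩
      · refine Finset.mem_coe.2 (Finset.mem_image.2 ⟨v, ?_, by rw [h, Sym2.eq_swap]⟩)
        exact Finset.mem_erase.2 ⟨key v u huv.symm h, Finset.mem_univ _⟩
  have h1 := Set.ncard_le_ncard hsub (Finset.finite_toSet _)
  rw [Set.ncard_coe_finset] at h1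
  have h2 := h1.trans Finset.card_image_le
  rw [Finset.card_erase_of_mem (Finset.mem_univ _), Finset.card_univ] at h2
  have h3 : 0 < Fintype.card (BroomVertex k m p q L) := Fintype.card_pos_iff.2 ⟨.inl 0⟩
  rw [← Nat.card_coe_set_eq] at h1 h2
  rw [Nat.card_eq_fintype_card (α := BroomVertex k m p q L)]
  omega

theorem level_add_level_le_dist (u v : BroomVertex k m p q L) :
    level u + level v + (if (label u).1.1 = (label v).1.1 then 0 else 1) ≤
      (graph k m p q L).dist u v + 2 * if (label u).1 = (label v).1 then
        (if label u = label v then min (level u) (level v)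
          else min (min (level u) (level v)) p) else 0 := by
  refine _root_.level_add_level_le_dist connected p level label ?_ u v
  have key : ∀ v w : BroomVertex k m p q L, parent v = w → (level v = 0 ∧ level w = 0) ∨
      (level v = level w + 1 ∧ (label v).1.1 = (label w).1.1 ∧
        (1 ≤ level w → (label v).1 = (label w).1) ∧ (p + 1 ≤ level w → label v = label w)) := by
    rintro v _ rfl
    by_cases h : level v = 0
    · left
      rw [parent, if_pos h]
      exact ⟨h, rfl⟩
    · exact Or.inr (parent_spec h)
  rintro v w ⟨-, h | h⟩
  · exact (key v w h).imp_right Or.inl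
  · exact (key w v h).imp And.symm Or.inr

theorem dist_le (hk : k ≤ 2) (u v : BroomVertex k m p q L) :
    (graph k m p q L).dist u v + 1 ≤ 2 * (p + q + 1) + k := by
  obtain ⟨P, hP⟩ := exists_walk_inl u
  obtain ⟨Q, hQ⟩ := exists_walk_inl v
  have h1 := SimpleGraph.dist_le P
  have h2 := SimpleGraph.dist_le Q
  have h3 := (connected (k := k) (m := m) (p := p) (q := q) (L := L)).dist_triangle
    (u := u) (v := .inl (label u).1.1) (w := v)
  have h4 := (connected (k := k) (m := m) (p := p) (q := q) (L := L)).dist_triangle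
    (u := .inl (label u).1.1) (v := .inl (label v).1.1) (w := v)
  rw [SimpleGraph.dist_comm (u := .inl (label v).1.1) (v := v)] at h4
  have h5 := level_le u
  have h6 := level_le v
  have h7 : ∀ z z' : Fin k, (graph k m p q L).dist (.inl z) (.inl z') + 1 ≤ k := by
    intro z z'
    by_cases hz : z = z'
    · subst hz
      rw [SimpleGraph.dist_self]
      exact Fin.pos z
    · have hadj : (graph k m p q L).Adj (.inl z) (.inl z') := by
        by_cases h0 : z' = 0
        · subst h0
          exact adj_inl_zero hz
        · have : z = 0 := by
            rw [Fin.ext_iff] at *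
            rw [Fin.val_zero] at *
            omega
          subst this
          exact (adj_inl_zero h0).symm
      rw [SimpleGraph.dist_eq_one_iff_adj.2 hadj]
      rw [Fin.ext_iff] at hz
      omega
  have := h7 (label u).1.1 (label v).1.1
  omega

theorem exists_le_dist (hk : k ≤ 2) (hm : 2 ≤ m) (hL : 2 ≤ L) :
    ∃ u v, 2 * (p + q + 1) + k ≤ (graph k m p q L).dist u v + 1 := by
  let u : BroomVertex k m p q L := .inr (.inr (.inr ⟨0, by omega⟩))
  let v : BroomVertex k m p q L := .inr (.inr (.inr ⟨1, by omega⟩))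
  refine ⟨u, v, ?_⟩
  have h := level_add_level_le_dist u v
  have hu : level u = p + q + 1 := rfl
  have hv : level v = p + q + 1 := rfl
  have hk0 := NeZero.ne k
  obtain rfl | rfl : k = 1 ∨ k = 2 := by omega
  · have hne : (label u).1 ≠ (label v).1 := by
      intro e
      have := congrArg (fun a => (a.2 : ℕ)) e
      simp only [label, u, v, Fin.val_ofNat, Nat.zero_div, Nat.zero_mod, Nat.div_one] at this
      rw [Nat.mod_eq_of_lt (by omega)] at this
      omega
    rw [if_neg hne] at h
    omega
  · have hne : (label u).1.1 ≠ (label v).1.1 := by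
      intro e
      have := congrArg Fin.val e
      simp [label, u, v] at this
    have hne' : (label u).1 ≠ (label v).1 := fun e => hne (by rw [e])
    rw [if_neg hne, if_neg hne'] at h
    omega

end

end BroomVertex

/-- If all classes of `f` have at most `c` elements, then `f` identifies at most `n c` ordered
pairs. -/
theorem sum_ite_apply_eq_le {V β : Type*} [Fintype V] [DecidableEq β] (f : V → β) (c : ℝ)
    (h : ∀ b, ∑ v, (if f v = b then (1 : ℝ) else 0) ≤ c) :
    ∑ u, ∑ v, (if f u = f v then (1 : ℝ) else 0) ≤ Fintype.card V * c := by
  rw [← nsmul_eq_mul]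
  refine Finset.sum_le_card_nsmul _ _ _ fun u _ => le_of_eq_of_le ?_ (h (f u))
  exact Finset.sum_congr rfl fun v _ => by simp only [eq_comm]

theorem sum_comp_fst {α : Type*} [Fintype α] (p : ℕ) (g : α → ℝ) :
    ∑ x : α × Fin p, g x.1 = (∑ a, g a) * p := by
  rw [Fintype.sum_prod_type, Finset.sum_mul]
  simp [mul_comm]

namespace BroomVertex

variable {k m p q L : ℕ}

theorem card_eq :
    Fintype.card (BroomVertex k m p q L) = k + k * m * p + 2 * (k * m * q) + L := by
  simp only [Fintype.card_sum, Fintype.card_prod, Fintype.card_fin]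
  ring

/-- The sum of the levels, the leaves having the largest level. -/
theorem sum_level : ∑ v : BroomVertex k m p q L, (level v : ℝ) =
    L * (p + q + 1) + k * m * (p * (p + 1) / 2) + 2 * (k * m) * (q * (p + 1) + q * (q - 1) / 2) := by
  have gauss : ∀ N : ℕ, ∑ j ∈ Finset.range N, (j : ℝ) = N * (N - 1) / 2 := by
    intro N
    induction N with
    | zero => simp
    | succ N ih => rw [Finset.sum_range_succ, ih]; push_cast; ring
  have gauss' : ∀ N : ℕ, ∑ j : Fin N, ((j : ℕ) : ℝ) = N * (N - 1) / 2 := by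
    intro N
    rw [← gauss N, Fin.sum_univ_eq_sum_range (fun j : ℕ => (j : ℝ))]
  rw [Fintype.sum_sum_type, Fintype.sum_sum_type, Fintype.sum_sum_type]
  simp only [level, Fintype.sum_prod_type, Finset.sum_const, Finset.card_univ, Fintype.card_fin,
    Fintype.card_prod,
    nsmul_eq_mul, Nat.cast_add, Nat.cast_one, Finset.sum_add_distrib, gauss', Nat.cast_zero]
  push_cast
  ring

variable [NeZero k] [NeZero m]

/-- The number of vertices in a class of the map `f ∘ label`, if at most `e` centres, `t` trunks and
`a` arms belong to it, and if its leaves lie in one residue class modulo `M`. -/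
theorem sum_ite_label_eq_le {β : Type*} [DecidableEq β] (f : (Fin k × Fin m) × Fin 2 → β) (b : β)
    {e t a : ℝ} {M c : ℕ}
    (he : ∑ z : Fin k, (if f ((z, 0), 0) = b then (1 : ℝ) else 0) ≤ e)
    (ht : ∑ x : Fin k × Fin m, (if f (x, 0) = b then (1 : ℝ) else 0) ≤ t)
    (ha : ∑ x : (Fin k × Fin m) × Fin 2, (if f x = b then (1 : ℝ) else 0) ≤ a)
    (hM : ∀ s : Fin L, f (label (.inr (.inr (.inr s)) : BroomVertex k m p q L)) = b →
      s.1 % M = c) :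
    ∑ v : BroomVertex k m p q L, (if f (label v) = b then (1 : ℝ) else 0) ≤
      e + t * p + a * q + (L / M + 1) := by
  rw [Fintype.sum_sum_type, Fintype.sum_sum_type, Fintype.sum_sum_type]
  have h1 : ∑ s : Fin L, (if f (label (.inr (.inr (.inr s)) : BroomVertex k m p q L)) = b
      then (1 : ℝ) else 0) ≤ L / M + 1 := by
    rw [Finset.sum_boole]
    have h2 := (Finset.card_le_card (Finset.monotone_filter_right Finset.univ
      (fun s _ h => hM s h))).trans (card_filter_mod_eq_le L M c)
    have h3 : ((L / M : ℕ) : ℝ) ≤ (L : ℝ) / M := Nat.cast_div_le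
    have h4 : ((Finset.univ.filter (fun s : Fin L =>
        f (label (.inr (.inr (.inr s)) : BroomVertex k m p q L)) = b)).card : ℝ) ≤
        ((L / M + 1 : ℕ) : ℝ) := by exact_mod_cast h2
    push_cast at h4
    linarith
  have h2 := mul_le_mul_of_nonneg_right ht (Nat.cast_nonneg (α := ℝ) p)
  have h3 := mul_le_mul_of_nonneg_right ha (Nat.cast_nonneg (α := ℝ) q)
  have h4 : ∑ x : (Fin k × Fin m) × Fin p,
      (if f (label (.inr (.inl x) : BroomVertex k m p q L)) = b then (1 : ℝ) else 0) =
      (∑ x : Fin k × Fin m, (if f (x, 0) = b then (1 : ℝ) else 0)) * p :=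
    sum_comp_fst p fun x => if f (x, 0) = b then (1 : ℝ) else 0
  have h5 : ∑ x : ((Fin k × Fin m) × Fin 2) × Fin q,
      (if f (label (.inr (.inr (.inl x)) : BroomVertex k m p q L)) = b then (1 : ℝ) else 0) =
      (∑ x : (Fin k × Fin m) × Fin 2, (if f x = b then (1 : ℝ) else 0)) * q :=
    sum_comp_fst q fun x => if f x = b then (1 : ℝ) else 0
  have h6 : ∑ z : Fin k, (if f (label (.inl z : BroomVertex k m p q L)) = b
      then (1 : ℝ) else 0) ≤ e := he
  rw [h4, h5]
  linarith

theorem sum_ite_center_le (b : Fin k) :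
    ∑ v : BroomVertex k m p q L, (if (label v).1.1 = b then (1 : ℝ) else 0) ≤
      Fintype.card (BroomVertex k m p q L) / k + 1 := by
  have hk : (k : ℝ) ≠ 0 := Nat.cast_ne_zero.2 (NeZero.ne k)
  refine (sum_ite_label_eq_le (fun x => x.1.1) b (e := 1) (t := m) (a := 2 * m) (M := k) (c := b)
    (by simp) ?_ ?_
    ?_).trans_eq ?_
  · exact (sum_comp_fst m fun z => if z = b then (1 : ℝ) else 0).trans_le (by simp)
  · refine (sum_comp_fst 2 fun x : Fin k × Fin m => if x.1 = b then (1 : ℝ) else 0).trans_le ?_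
    refine (congrArg (· * ((2 : ℕ) : ℝ))
      (sum_comp_fst m fun z => if z = b then (1 : ℝ) else 0)).trans_le ?_
    simp [mul_comm]
  · rintro s rfl
    simp [label]
  · rw [card_eq]
    push_cast
    field_simp
    ring

theorem sum_ite_trunk_le (b : Fin k × Fin m) :
    ∑ v : BroomVertex k m p q L, (if (label v).1 = b then (1 : ℝ) else 0) ≤
      L / (k * m) + (p + 2 * q + 2) := by
  refine (sum_ite_label_eq_le Prod.fst b (e := 1) (t := 1) (a := 2) (M := k * m)
    (c := b.1 + k * b.2) ?_ (by simp)
    ((sum_comp_fst 2 fun x => if x = b then (1 : ℝ) else 0).trans_le (by simp)) ?_).trans_eq ?_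
  · obtain ⟨z, i⟩ := b
    refine le_trans (Finset.sum_le_sum (g := fun z' => if z' = z then (1 : ℝ) else 0)
      fun z' _ => ?_) (by simp)
    simp only [Prod.mk.injEq]
    split_ifs <;> first | tauto | norm_num
  · rintro s rfl
    simp [label, Nat.mod_mul]
  · push_cast
    ring

theorem sum_ite_arm_le (b : (Fin k × Fin m) × Fin 2) :
    ∑ v : BroomVertex k m p q L, (if label v = b then (1 : ℝ) else 0) ≤
      L / (2 * (k * m)) + (p + q + 2) := by
  refine (sum_ite_label_eq_le id b (e := 1) (t := 1) (a := 1) (M := k * m * 2)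
    (c := b.1.1 + k * b.1.2 + k * m * b.2) ?_ ?_ (by simp) ?_).trans_eq ?_
  · obtain ⟨⟨z, i⟩, j⟩ := b
    refine le_trans (Finset.sum_le_sum (g := fun z' => if z' = z then (1 : ℝ) else 0)
      fun z' _ => ?_) (by simp)
    simp only [Prod.mk.injEq, id]
    split_ifs <;> first | tauto | norm_num
  · obtain ⟨x, j⟩ := b
    refine le_trans (Finset.sum_le_sum (g := fun x' => if x' = x then (1 : ℝ) else 0)
      fun x' _ => ?_) (by simp)
    simp only [Prod.mk.injEq, id]
    split_ifs <;> first | tauto | norm_num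
  · rintro s rfl
    simp [label, Nat.mod_mul]
  · push_cast
    ring

/-- The distances, estimated by `level_add_level_le_dist`: two vertices in a common trunk lose at
most `2 p`, and two vertices in a common arm at most `2 (q + 1)` more. -/
theorem le_sum_dist :
    2 * (Fintype.card (BroomVertex k m p q L) : ℝ) * (L * (p + q + 1) + k * m * (p * (p + 1) / 2)
        + 2 * (k * m) * (q * (p + 1) + q * (q - 1) / 2))
      + (Fintype.card (BroomVertex k m p q L) : ℝ) ^ 2
      - (Fintype.card (BroomVertex k m p q L) : ℝ) *
        (Fintype.card (BroomVertex k m p q L) / k + 1)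
      - 2 * p * (Fintype.card (BroomVertex k m p q L) * (L / (k * m) + (p + 2 * q + 2)))
      - 2 * (q + 1) * (Fintype.card (BroomVertex k m p q L) * (L / (2 * (k * m)) + (p + q + 2)))
    ≤ ∑ u, ∑ v, ((graph k m p q L).dist u v : ℝ) := by
  set n : ℝ := (Fintype.card (BroomVertex k m p q L) : ℝ) with hn
  have h1 := sum_ite_apply_eq_le (fun v : BroomVertex k m p q L => (label v).1.1) _
    sum_ite_center_le
  have h2 := mul_le_mul_of_nonneg_left
    (sum_ite_apply_eq_le (fun v : BroomVertex k m p q L => (label v).1) _ sum_ite_trunk_le)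
    (show (0 : ℝ) ≤ 2 * p by positivity)
  have h3 := mul_le_mul_of_nonneg_left
    (sum_ite_apply_eq_le (fun v : BroomVertex k m p q L => label v) _ sum_ite_arm_le)
    (show (0 : ℝ) ≤ 2 * (q + 1) by positivity)
  have hpair : ∀ u v : BroomVertex k m p q L, (level u : ℝ) + level v + 1
      - (if (label u).1.1 = (label v).1.1 then (1 : ℝ) else 0)
      - 2 * p * (if (label u).1 = (label v).1 then (1 : ℝ) else 0)
      - 2 * (q + 1) * (if label u = label v then (1 : ℝ) else 0)
      ≤ ((graph k m p q L).dist u v : ℝ) := by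
    intro u v
    have h := level_add_level_le_dist u v
    have hu := level_le u
    have key : level u + level v + 1 ≤ (graph k m p q L).dist u v
        + (if (label u).1.1 = (label v).1.1 then 1 else 0)
        + 2 * p * (if (label u).1 = (label v).1 then 1 else 0)
        + 2 * (q + 1) * (if label u = label v then 1 else 0) := by
      by_cases ha : label u = label v
      · simp only [ha, if_true] at h ⊢
        omega
      · simp only [ha, if_false] at h ⊢
        split_ifs at h ⊢ <;> omega
    have key' : ((level u + level v + 1 : ℕ) : ℝ) ≤ (((graph k m p q L).dist u v
        + (if (label u).1.1 = (label v).1.1 then 1 else 0)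
        + 2 * p * (if (label u).1 = (label v).1 then 1 else 0)
        + 2 * (q + 1) * (if label u = label v then 1 else 0) : ℕ) : ℝ) := Nat.cast_le.2 key
    push_cast at key'
    linarith
  have hsum := Finset.sum_le_sum fun u (_ : u ∈ Finset.univ) =>
    Finset.sum_le_sum fun v (_ : v ∈ Finset.univ) => hpair u v
  simp only [Finset.sum_add_distrib, Finset.sum_sub_distrib, ← Finset.mul_sum,
    Finset.sum_const, Finset.card_univ, nsmul_eq_mul, mul_one] at hsum
  rw [sum_level] at hsum
  rw [← hn] at *
  linarith

end BroomVertex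

/-- The lower bound for trees with `n` vertices, in terms of the parameters of the family. -/
theorem exists_isTree_le_wienerIndex {k m p q L n : ℕ} (hk0 : 1 ≤ k) (hk : k ≤ 2) (hm : 2 ≤ m)
    (hL : 2 ≤ L) (hn : n = k + k * m * p + 2 * (k * m * q) + L) :
    ∃ T : SimpleGraph (Fin n), T.IsTree ∧ T.diam + 1 = 2 * (p + q + 1) + k ∧
      2 * (n : ℝ) * (L * (p + q + 1) + k * m * (p * (p + 1) / 2)
        + 2 * (k * m) * (q * (p + 1) + q * (q - 1) / 2))
      + (n : ℝ) ^ 2 - (n : ℝ) * (n / k + 1)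
      - 2 * p * (n * (L / (k * m) + (p + 2 * q + 2)))
      - 2 * (q + 1) * (n * (L / (2 * (k * m)) + (p + q + 2))) ≤ 2 * (T.wienerIndex : ℝ) := by
  have : NeZero k := ⟨by omega⟩
  have : NeZero m := ⟨by omega⟩
  have hcard : Fintype.card (BroomVertex k m p q L) = n := by rw [BroomVertex.card_eq, hn]
  let e : BroomVertex k m p q L ≃ Fin n := Fintype.equivFinOfCardEq hcard
  let φ := SimpleGraph.Iso.map e (BroomVertex.graph k m p q L)
  have hdist := φ.dist_eq BroomVertex.connected
  have htree := φ.isTree_iff.1 BroomVertex.isTree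
  have hne := htree.connected.nonempty
  refine ⟨_, htree, ?_, ?_⟩
  · apply le_antisymm
    · obtain ⟨u, v, huv⟩ :=
        ((BroomVertex.graph k m p q L).map e).exists_dist_eq_diam
      rw [← huv, ← φ.apply_symm_apply u, ← φ.apply_symm_apply v, hdist]
      exact BroomVertex.dist_le hk _ _
    · obtain ⟨u, v, huv⟩ := BroomVertex.exists_le_dist (k := k) (m := m) (p := p) (q := q) (L := L)
        hk hm hL
      rw [← hdist] at huv
      have := SimpleGraph.dist_le_diam
        (SimpleGraph.connected_iff_ediam_ne_top.1 htree.connected) (u := φ u) (v := φ v)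
      omega
  · have h2 : (2 * ((BroomVertex.graph k m p q L).map e).wienerIndex : ℝ) =
        ∑ u, ∑ v, (((BroomVertex.graph k m p q L).map e).dist u v : ℝ) := by
      exact_mod_cast SimpleGraph.two_mul_wienerIndex _
    have h3 : ∑ u, ∑ v, (((BroomVertex.graph k m p q L).map e).dist u v : ℝ) =
        ∑ u, ∑ v, ((BroomVertex.graph k m p q L).dist u v : ℝ) := by
      rw [← φ.toEquiv.sum_comp]
      refine Finset.sum_congr rfl fun u _ => ?_
      rw [← φ.toEquiv.sum_comp]
      exact Finset.sum_congr rfl fun v _ => congrArg _ (hdist u v)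
    have h4 := BroomVertex.le_sum_dist (k := k) (m := m) (p := p) (q := q) (L := L)
    rw [hcard] at h4
    rw [h2, h3]
    exact h4

/-! ### Asymptotics -/

theorem rpow_three_halves {x : ℝ} (hx : 0 ≤ x) : x ^ (3 / 2 : ℝ) = x * √x := by
  rw [show (3 / 2 : ℝ) = 1 + 1 / 2 by norm_num, Real.rpow_add' hx (by norm_num), Real.rpow_one,
    Real.sqrt_eq_rpow]

/-- With `x = √(a + 1)` and `y = √a`, this is `0 ≤ (x - y)² (x + 2 y)`. -/
theorem add_one_mul_sqrt_le {a : ℝ} (ha : 0 ≤ a) :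
    (a + 1) * √(a + 1) ≤ a * √a + 3 / 2 * √(a + 1) := by
  have hx := Real.sq_sqrt (show 0 ≤ a + 1 by linarith)
  have hy := Real.sq_sqrt ha
  have hx0 := Real.sqrt_nonneg (a + 1)
  have hy0 := Real.sqrt_nonneg a
  set x := √(a + 1)
  set y := √a
  have h : 0 ≤ (x - y) ^ 2 * (x + 2 * y) := by positivity
  have e : x ^ 2 - y ^ 2 = 1 := by linarith
  have e2 : 3 / 2 * x = 3 / 2 * x * (x ^ 2 - y ^ 2) := by rw [e, mul_one]
  rw [← hx, ← hy, e2]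
  nlinarith

theorem le_sum_sqrt (r : ℕ) : 4 / 3 * ((r : ℝ) * √r) - 2 * √(r : ℝ) ≤
    ∑ j ∈ Finset.Ico 1 r, 2 * √((r : ℝ) - j) := by
  induction r with
  | zero => simp
  | succ r ih =>
    rcases Nat.eq_zero_or_pos r with rfl | hr
    · norm_num
    · rw [Finset.sum_eq_sum_Ico_succ_bot (by omega), ← Finset.sum_Ico_add' _ 1 r 1]
      have h : ∑ j ∈ Finset.Ico 1 r, 2 * √(((r + 1 : ℕ) : ℝ) - ((j + 1 : ℕ) : ℝ)) =
          ∑ j ∈ Finset.Ico 1 r, 2 * √((r : ℝ) - j) :=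
        Finset.sum_congr rfl fun j _ => by push_cast; rw [add_sub_add_right_eq_sub]
      rw [h]
      have := add_one_mul_sqrt_le (Nat.cast_nonneg (α := ℝ) r)
      push_cast
      rw [add_sub_cancel_right]
      linarith

/-- The coefficient of the upper bound in terms of the diameter `2 r + ε`. -/
theorem sqrt_two_div_three_mul_le {r ε : ℕ} (hε : ε ≤ 1) :
    √2 / 3 * (((2 * r + ε : ℕ) : ℝ) ^ (3 / 2 : ℝ)) - 3 * √((2 * r + ε : ℕ) : ℝ) ≤
      ∑ j ∈ Finset.Ico 1 r, 2 * √((r : ℝ) - j) := by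
  refine le_trans ?_ (le_sum_sqrt r)
  rw [rpow_three_halves (Nat.cast_nonneg _)]
  have hr0 : (0 : ℝ) ≤ r := Nat.cast_nonneg r
  have h2 : √2 ≤ 3 / 2 := by
    rw [Real.sqrt_le_left (by norm_num)]; norm_num
  have h2' : √2 * √2 = 2 := Real.mul_self_sqrt (by norm_num)
  have h20 := Real.sqrt_nonneg 2
  set d : ℝ := ((2 * r + ε : ℕ) : ℝ) with hd
  have hrd : √(r : ℝ) ≤ √d := Real.sqrt_le_sqrt (by rw [hd]; exact_mod_cast (by omega))
  have hd0 := Real.sqrt_nonneg d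
  have h : d * √d ≤ 2 * r * √(2 * r) + 3 / 2 * √d := by
    rcases Nat.le_one_iff_eq_zero_or_eq_one.1 hε with rfl | rfl
    · rw [hd]; push_cast; rw [add_zero]
      have := Real.sqrt_nonneg (2 * (r : ℝ))
      linarith
    · rw [hd]; push_cast
      exact add_one_mul_sqrt_le (by positivity)
  rw [Real.sqrt_mul (by norm_num)] at h
  have h3 := mul_le_mul_of_nonneg_left h (show 0 ≤ √2 / 3 by positivity)
  have h4 : √2 / 3 * (2 * r * (√2 * √r) + 3 / 2 * √d) =
      2 / 3 * (√2 * √2) * (r * √r) + √2 / 2 * √d := by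
    ring
  rw [h4, h2'] at h3
  have h5 := mul_le_mul_of_nonneg_right h2 hd0
  linarith

/-- The losses of the family of trees are at most `(49 / 36) (r n) ^ (3 / 2)`, up to `O(n)`; here
`x = √n`, `y = √r`, and `M ≈ (6 / 5) x / y` is the number of trunks. The vertices of trunks and arms
account for `24 / 36`, and the pairs of leaves in a common trunk or arm for `25 / 36`. -/
theorem broom_loss_le {n x y k M p q r L : ℝ} (hn0 : 0 ≤ n) (hx0 : 0 < x) (hy0 : 0 ≤ y)
    (hxx : x * x = n) (hyy : y * y = r) (hkR : k ≤ 2) (hM0 : 0 < M)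
    (hM1 : 6 / 5 * x ≤ M * y) (hM2 : M * y ≤ 6 / 5 * x + k * y) (hp0 : 0 ≤ p) (hq0 : 0 ≤ q)
    (hpr : p + q + 1 = r) (hq1 : 3 * q ≤ r) (hq2 : r ≤ 3 * q + 2) (hLn : L ≤ n) :
    n * (L / M) * (p + (q + 1) / 2) + n * (M * ((p ^ 2 + p) / 2 + p * q + q ^ 2 + q)) +
      n * (k * r + 1 / 2 + p * (p + 2 * q + 2) + (q + 1) * (p + q + 2)) ≤
    49 / 36 * (r * y) * (n * x) + (10 * r ^ 2 + 10 * r + 1) * n := by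
  have hr0 : 0 ≤ r := by linarith
  -- the pairs in a common trunk or arm
  have hLM : (L : ℝ) / M ≤ 5 / 6 * (x * y) := by
    rw [div_le_iff₀ hM0]
    have := mul_le_mul_of_nonneg_left hM1 hx0.le
    nlinarith
  have hcommon : n * (L / M) * (p + (q + 1) / 2) ≤ 25 / 36 * (r * y) * (n * x) := by
    have h1 : (p : ℝ) + (q + 1) / 2 ≤ 5 / 6 * r := by linarith
    have h2 := mul_le_mul hLM h1 (by positivity) (by positivity)
    have h3 := mul_le_mul_of_nonneg_left h2 hn0
    linarith
  -- the vertices of trunks and arms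
  have hinner : n * (M * ((p ^ 2 + p) / 2 + p * q + q ^ 2 + q)) ≤
      2 / 3 * (r * y) * (n * x) + 2 * r ^ 2 * n := by
    have h1 : ((p : ℝ) ^ 2 + p) / 2 + p * q + q ^ 2 + q ≤ 5 / 9 * (r * (y * y)) := by
      rw [hyy]
      have hp' : (p : ℝ) = r - q - 1 := by linarith
      rw [hp']
      linarith [mul_nonneg hq0 (sub_nonneg.2 hq1), mul_nonneg hr0 (sub_nonneg.2 hq1)]
    have h2 := mul_le_mul_of_nonneg_left h1 hM0.le
    have h3 : M * (5 / 9 * (r * (y * y))) ≤ (6 / 5 * x + k * y) * (5 / 9 * (r * y)) := by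
      have := mul_le_mul_of_nonneg_right hM2 (show 0 ≤ 5 / 9 * (r * y) by positivity)
      linarith
    have h4 : (6 / 5 * x + k * y) * (5 / 9 * (r * y)) =
        2 / 3 * (r * y) * x + 5 / 9 * k * r * (y * y) := by ring
    rw [hyy] at h4
    have h5 : 5 / 9 * k * r * (r : ℝ) ≤ 2 * r ^ 2 := by
      nlinarith [mul_le_mul_of_nonneg_right hkR (mul_nonneg hr0 hr0)]
    have h6 := mul_le_mul_of_nonneg_left (show M * (((p : ℝ) ^ 2 + p) / 2 + p * q + q ^ 2 + q) ≤
      2 / 3 * (r * y) * x + 2 * r ^ 2 by linarith) hn0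
    linarith
  have hrest : n * (k * r + 1 / 2 + p * (p + 2 * q + 2) + (q + 1) * (p + q + 2)) ≤
      (8 * r ^ 2 + 10 * r + 1) * (n : ℝ) := by
    rw [mul_comm]
    refine mul_le_mul_of_nonneg_right ?_ hn0
    have hpr' : (p : ℝ) ≤ r := by linarith
    have h1 := mul_le_mul hpr' (show (p : ℝ) + 2 * q + 2 ≤ 2 * r + 2 by linarith) (by positivity)
      (by linarith)
    have h2 := mul_le_mul (show (q : ℝ) + 1 ≤ r by linarith)
      (show (p : ℝ) + q + 2 ≤ r + 1 by linarith) (by positivity) (by linarith)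
    have h3 := mul_le_mul_of_nonneg_right hkR (show (0 : ℝ) ≤ r by linarith)
    nlinarith
  linarith

/-- The lower bound. The parameters of the tree: the trunks split at distance about `r / 3` from the
leaves, and there are about `(6 / 5) √(n / r)` trunks. -/
theorem exists_isTree_ge {k r n : ℕ} (hk0 : 1 ≤ k) (hk : k ≤ 2) (hr : 1 ≤ r)
    (hn : 8 * (r : ℝ) + 8 ≤ √n) :
    ∃ T : SimpleGraph (Fin n), T.IsTree ∧ T.diam + 1 = 2 * r + k ∧
      (r + (k - 1) / 4 : ℝ) * (n : ℝ) ^ 2 - 49 / 36 * (r * √r) * (n * √n)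
        - (10 * r ^ 2 + 10 * r + 1) * n ≤ (T.wienerIndex : ℝ) := by
  have hn0 : (0 : ℝ) ≤ n := Nat.cast_nonneg n
  have hr1 : (1 : ℝ) ≤ r := by exact_mod_cast hr
  have hxx : √(n : ℝ) * √n = n := Real.mul_self_sqrt hn0
  have hyy : √(r : ℝ) * √r = r := Real.mul_self_sqrt (by linarith)
  have hy1 : 1 ≤ √(r : ℝ) := Real.one_le_sqrt.2 hr1
  set x : ℝ := √n
  set y : ℝ := √r
  have hyr : y ≤ r := by nlinarith
  have hkR0 : (1 : ℝ) ≤ k := by exact_mod_cast hk0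
  have hkR : (k : ℝ) ≤ 2 := by exact_mod_cast hk
  obtain ⟨q, hq⟩ : ∃ q, q = r / 3 := ⟨_, rfl⟩
  obtain ⟨p, hp⟩ : ∃ p, p + q + 1 = r := ⟨r - 1 - q, by omega⟩
  obtain ⟨m, hm⟩ : ∃ m, m = ⌈6 / 5 * x / (y * k)⌉₊ := ⟨_, rfl⟩
  have hx0 : 0 < x := by linarith
  have hval : 0 ≤ 6 / 5 * x / (y * k) := by positivity
  have hm1 : 6 / 5 * x / (y * k) ≤ m := by rw [hm]; exact Nat.le_ceil _
  have hm2 : (m : ℝ) ≤ 6 / 5 * x / (y * k) + 1 := by rw [hm]; exact (Nat.ceil_lt_add_one hval).le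
  -- `M = k m` is the number of trunks
  set M : ℝ := k * m with hM
  have hyk : 0 < y * k := by positivity
  have hM1 : 6 / 5 * x ≤ M * y := by
    rw [div_le_iff₀ hyk] at hm1
    rw [hM]; linarith
  have hM2 : M * y ≤ 6 / 5 * x + k * y := by
    have : (m : ℝ) * (y * k) ≤ 6 / 5 * x + y * k := by
      have h1 := mul_le_mul_of_nonneg_right hm2 hyk.le
      rw [add_mul, div_mul_cancel₀ _ hyk.ne'] at h1
      linarith
    rw [hM]; linarith
  have hM0 : 0 < M := by
    by_contra h
    have : M * y ≤ 0 := mul_nonpos_of_nonpos_of_nonneg (not_lt.1 h) (by linarith)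
    linarith
  have hm2' : 2 ≤ m := by
    have : (1 : ℝ) < m := by
      refine lt_of_lt_of_le ?_ hm1
      rw [lt_div_iff₀ hyk]
      nlinarith
    exact_mod_cast this
  have hMle : M ≤ 6 / 5 * x + 2 := by nlinarith
  have hpr : (p : ℝ) + q + 1 = r := by exact_mod_cast hp
  have hp0 : (0 : ℝ) ≤ p := Nat.cast_nonneg p
  have hq0 : (0 : ℝ) ≤ q := Nat.cast_nonneg q
  have hq1 : 3 * (q : ℝ) ≤ r := by exact_mod_cast (by omega : 3 * q ≤ r)
  have hq2 : (r : ℝ) ≤ 3 * q + 2 := by exact_mod_cast (by omega : r ≤ 3 * q + 2)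
  obtain ⟨L, hL2, hL⟩ : ∃ L, 2 ≤ L ∧ n = k + k * m * p + 2 * (k * m * q) + L := by
    have h : (k + k * m * p + 2 * (k * m * q) + 2 : ℝ) ≤ n := by
      rw [← hM, ← hxx]
      have h1 : M * (p + 2 * q) ≤ (6 / 5 * x + 2) * (2 * r) :=
        mul_le_mul hMle (by linarith) (by positivity) (by positivity)
      nlinarith
    have h' : k + k * m * p + 2 * (k * m * q) + 2 ≤ n := by exact_mod_cast h
    exact ⟨n - (k + k * m * p + 2 * (k * m * q)), by omega, by omega⟩
  obtain ⟨T, hT1, hT2, hT3⟩ := exists_isTree_le_wienerIndex hk0 hk hm2' hL2 hL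
  refine ⟨T, hT1, by rw [hT2, hp], ?_⟩
  have hLR : (L : ℝ) = n - (k + M * p + 2 * (M * q)) := by
    rw [hM, hL]; push_cast; ring
  have hLn : (L : ℝ) ≤ n := by rw [hLR]; linarith [mul_nonneg hM0.le hp0, mul_nonneg hM0.le hq0]
  rw [← hM, hpr] at hT3
  have hkk : (n : ℝ) / k = n - (k - 1) / 2 * n := by
    obtain rfl | rfl : k = 1 ∨ k = 2 := by omega
    · norm_num
    · norm_num; ring
  have hloss := broom_loss_le hn0 hx0 (by linarith) hxx hyy hkR hM0 hM1 hM2 hp0 hq0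
    hpr hq1 hq2 hLn
  have hL2M : (L : ℝ) / (2 * M) = L / M / 2 := by rw [div_div, mul_comm]
  rw [hkk, hL2M] at hT3
  have hexp : 2 * (n : ℝ) * (L * r + M * (p * (p + 1) / 2) +
        2 * M * (q * (p + 1) + q * (q - 1) / 2)) =
      2 * (r * n ^ 2 - n * (k * r) - n * (M * ((p ^ 2 + p) / 2 + p * q + q ^ 2 + q))) := by
    rw [hLR, ← hpr]
    ring
  rw [hexp] at hT3
  linarith

theorem maxTreeWiener_le {n d : ℕ} {b : ℝ} (h : (treeWienerIndices n d).Nonempty)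
    (hb : ∀ T : SimpleGraph (Fin n), T.IsTree → T.diam = d → (T.wienerIndex : ℝ) ≤ b) :
    (maxTreeWiener n d : ℝ) ≤ b := by
  obtain ⟨T, h1, h2, h3⟩ := (isGreatest_maxTreeWiener h).1
  rw [← h3]
  exact hb T h1 h2

/-- Both bounds for diameter `2 r + ε`, where `ε` is the parity. -/
theorem maxTreeWiener_bounds {r ε : ℕ} (hr : 1 ≤ r) (hε : ε ≤ 1) :
    ∃ C₁ C₂ : ℝ, ∀ᶠ n : ℕ in atTop,
      (r + ε / 4 : ℝ) * (n : ℝ) ^ 2 - 29 / 60 * ((2 * r + ε : ℕ) : ℝ) ^ (3 / 2 : ℝ) *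
        (n : ℝ) ^ (3 / 2 : ℝ) + C₁ * n ≤ (maxTreeWiener n (2 * r + ε) : ℝ) ∧
      (maxTreeWiener n (2 * r + ε) : ℝ) ≤ (r + ε / 4 : ℝ) * (n : ℝ) ^ 2 -
        (√2 / 3 * ((2 * r + ε : ℕ) : ℝ) ^ (3 / 2 : ℝ) + -3 * √((2 * r + ε : ℕ) : ℝ)) *
          (n : ℝ) ^ (3 / 2 : ℝ) + C₂ * n := by
  refine ⟨-(10 * r ^ 2 + 10 * r + 1), (∑ j ∈ Finset.Ico 1 r, 2 * √((r : ℝ) - j)) ^ 2, ?_⟩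
  have hlarge : ∀ᶠ n : ℕ in atTop, 8 * (r : ℝ) + 8 ≤ √(n : ℝ) :=
    (Real.tendsto_sqrt_atTop.comp tendsto_natCast_atTop_atTop).eventually_ge_atTop _
  filter_upwards [hlarge] with n hn
  obtain ⟨T, hT, hdiam, hW⟩ := exists_isTree_ge (k := ε + 1) (by omega) (by omega) hr hn
  have hdiam' : T.diam = 2 * r + ε := by omega
  have hmem : T.wienerIndex ∈ treeWienerIndices n (2 * r + ε) := ⟨T, hT, hdiam', rfl⟩
  rw [rpow_three_halves (Nat.cast_nonneg n)]
  have hnn : (0 : ℝ) ≤ n * √(n : ℝ) := by positivity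
  constructor
  · -- `√2 > 1.41` just suffices to compare `49 / 36` with `2 √2 * 29 / 60`
    have h1 : (T.wienerIndex : ℝ) ≤ maxTreeWiener n (2 * r + ε) := by
      exact_mod_cast (isGreatest_maxTreeWiener ⟨_, hmem⟩).2 hmem
    have h2 : 49 / 36 * ((r : ℝ) * √r) ≤ 29 / 60 * ((2 * r + ε : ℕ) : ℝ) ^ (3 / 2 : ℝ) := by
      rw [rpow_three_halves (Nat.cast_nonneg _)]
      have h3 : (2 * r : ℝ) ≤ ((2 * r + ε : ℕ) : ℝ) := by 
        push_cast; linarith [Nat.cast_nonneg (α := ℝ) ε]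
      have h4 : √2 * √(r : ℝ) ≤ √((2 * r + ε : ℕ) : ℝ) := by
        rw [← Real.sqrt_mul (by norm_num)]
        exact Real.sqrt_le_sqrt h3
      have h5 := mul_le_mul h3 h4 (by positivity) (by positivity)
      have h6 : (1.41 : ℝ) ≤ √2 := Real.le_sqrt_of_sq_le (by norm_num)
      have h60 : (0 : ℝ) ≤ r * √r := by positivity
      have h7 := mul_le_mul_of_nonneg_right h6 h60
      linarith
    have h3 := mul_le_mul_of_nonneg_right h2 hnn
    push_cast at hW h3 ⊢
    rw [add_sub_cancel_right] at hW
    linarith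
  · refine maxTreeWiener_le ⟨_, hmem⟩ fun G hG hd => (hG.wienerIndex_le hε hd).trans ?_
    have h1 := mul_le_mul_of_nonneg_right (sqrt_two_div_three_mul_le (r := r) hε) hnn
    linarith

theorem mainTheorem7 :
    -- even diameter
    (∃ f h : ℕ → ℝ,
      f =o[atTop] (fun d : ℕ => (d : ℝ) ^ (3 / 2 : ℝ)) ∧
      h =O[atTop] (fun d : ℕ => Real.sqrt (d : ℝ)) ∧
      ∀ d : ℕ, 2 ≤ d → Even d →
        ∃ r s : ℕ → ℝ,
          r =O[atTop] (fun n : ℕ => (n : ℝ)) ∧ s =O[atTop] (fun n : ℕ => (n : ℝ)) ∧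
          ∀ᶠ n : ℕ in atTop,
            (d : ℝ) / 2 * (n : ℝ) ^ 2
                - (29 / 60 * (d : ℝ) ^ (3 / 2 : ℝ) + f d) * (n : ℝ) ^ (3 / 2 : ℝ) + r n
              ≤ (maxTreeWiener n d : ℝ) ∧
            (maxTreeWiener n d : ℝ)
              ≤ (d : ℝ) / 2 * (n : ℝ) ^ 2
                - (Real.sqrt 2 / 3 * (d : ℝ) ^ (3 / 2 : ℝ) + h d) * (n : ℝ) ^ (3 / 2 : ℝ) + s n) ∧
    -- odd diameter
    (∃ f h : ℕ → ℝ,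
      f =o[atTop] (fun d : ℕ => (d : ℝ) ^ (3 / 2 : ℝ)) ∧
      h =O[atTop] (fun d : ℕ => Real.sqrt (d : ℝ)) ∧
      ∀ d : ℕ, 2 ≤ d → Odd d →
        ∃ r s : ℕ → ℝ,
          r =O[atTop] (fun n : ℕ => (n : ℝ)) ∧ s =O[atTop] (fun n : ℕ => (n : ℝ)) ∧
          ∀ᶠ n : ℕ in atTop,
            ((d : ℝ) - 1 / 2) / 2 * (n : ℝ) ^ 2
                - (29 / 60 * (d : ℝ) ^ (3 / 2 : ℝ) + f d) * (n : ℝ) ^ (3 / 2 : ℝ) + r n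
              ≤ (maxTreeWiener n d : ℝ) ∧
            (maxTreeWiener n d : ℝ)
              ≤ ((d : ℝ) - 1 / 2) / 2 * (n : ℝ) ^ 2
                - (Real.sqrt 2 / 3 * (d : ℝ) ^ (3 / 2 : ℝ) + h d) * (n : ℝ) ^ (3 / 2 : ℝ) + s n) := by
  have hO : ∀ C : ℝ, (fun n : ℕ => C * (n : ℝ)) =O[atTop] (fun n : ℕ => (n : ℝ)) := fun C =>
    (isBigO_refl _ _).const_mul_left C
  have hh : (fun d : ℕ => -3 * √(d : ℝ)) =O[atTop] (fun d : ℕ => √(d : ℝ)) :=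
    (isBigO_refl _ _).const_mul_left _
  refine ⟨⟨fun _ => 0, fun d => -3 * √(d : ℝ), isLittleO_zero _ _, hh, ?_⟩,
    ⟨fun _ => 0, fun d => -3 * √(d : ℝ), isLittleO_zero _ _, hh, ?_⟩⟩
  · rintro d hd2 hd
    obtain ⟨r, rfl⟩ := hd.two_dvd
    obtain ⟨C₁, C₂, hC⟩ := maxTreeWiener_bounds (r := r) (ε := 0) (by omega) (by omega)
    refine ⟨_, _, hO C₁, hO C₂, hC.mono fun n hn => ?_⟩
    have h : ((2 * r : ℕ) : ℝ) / 2 = r + (0 : ℕ) / 4 := by push_cast; ring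
    rw [h, add_zero]
    exact hn
  · rintro d hd2 ⟨r, rfl⟩
    obtain ⟨C₁, C₂, hC⟩ := maxTreeWiener_bounds (r := r) (ε := 1) (by omega) le_rfl
    refine ⟨_, _, hO C₁, hO C₂, hC.mono fun n hn => ?_⟩
    have h : (((2 * r + 1 : ℕ) : ℝ) - 1 / 2) / 2 = r + (1 : ℕ) / 4 := by push_cast; ring
    rw [h, add_zero]
    exact hn
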